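/- Let $(\varphi_e)_{e\in\mathbb N}$ be a standard (Gödel) enumeration of the partial computable functions $\mathbb N\rightharpoonup\mathbb N$, and let $\langle\cdot,\cdot\rangle$ be a computable pairing bijection $\mathbb N^2\to\mathbb N$. For an equivalence relation $\equiv$ on $\mathbb N$, call $e$ an index of the equivalence structure $(\mathbb N,\equiv)$ if $\varphi_e$ is total and is the characteristic function of $\equiv$, that is, $\varphi_e(\langle x,y\rangle)=1$ if $x\equiv y$ and $\varphi_e(\langle x,y\rangle)=0$ otherwise. A structure $\mathcal A$ is ultrahomogeneous if every isomorphism between finitely generated substructures of $\mathcal A$ extends to an automorphism of $\mathcal A$. It is weakly ultrahomogeneous if there are finitely many elements $a_1,\dots,a_n$ of $\mathcal A$ such that $(\mathcal A,a_1,\dots,a_n)$, the expansion of $\mathcal A$ by constants naming these elements, is ultrahomogeneous. Let $EQ$, $UHQ$ and $WUQ$ be the sets of all indices of, respectively, equivalence structures, ultrahomogeneous equivalence structures, and weakly ultrahomogeneous equivalence structures with universe $\mathbb N$. For a class $\Gamma$ of subsets of $\mathbb N$ (here $\Pi^0_2$ or $\Sigma^0_3$ in the arithmetical hierarchy), a set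 $B\subseteq\mathbb N$ is $\Gamma$ complete if $B\in\Gamma$ and for every $A\in\Gamma$ there is a computable $f:\mathbb N\to\mathbb N$ such that $i\in A\iff f(i)\in B$ for all $i$. A set $B$ is $\Gamma$ complete relative to a set $C\subseteq\mathbb N$ if $B=C\cap R$ for some $R\in\Gamma$ and for every $A\in\Gamma$ there is a computable $f:\mathbb N\to\mathbb N$ such that, for all $i$, $f(i)\in C$ and $i\in A\iff f(i)\in B$. **Theorem.** (a) The index set $UHQ$ is $\Pi^0_2$ complete, and in fact $\Pi^0_2$ complete relative to $EQ$. (b) The index set $WUQ$ is $\Sigma^0_3$ complete, and in fact $\Sigma^0_3$ complete relative to $EQ$. -/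

import Mathlib

open FirstOrder

namespace EqIndex

/-! ### The arithmetical hierarchy -/

mutual

/-- `IsSigma n A`: the set `A ⊆ ℕ` is `Σ⁰ₙ`, i.e. it is defined by `n` alternating number
quantifiers, the first one existential, in front of a computable relation. -/
def IsSigma : ℕ → Set ℕ → Prop
  | 0, A => ComputablePred fun x => x ∈ A
  | n + 1, A => ∃ B : Set ℕ, IsPi n B ∧ ∀ x, x ∈ A ↔ ∃ y, Nat.pair x y ∈ B

/-- `IsPi n A`: the set `A ⊆ ℕ` is `Π⁰ₙ`, i.e. it is defined by `n` alternating number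
quantifiers, the first one universal, in front of a computable relation. -/
def IsPi : ℕ → Set ℕ → Prop
  | 0, A => ComputablePred fun x => x ∈ A
  | n + 1, A => ∃ B : Set ℕ, IsSigma n B ∧ ∀ x, x ∈ A ↔ ∀ y, Nat.pair x y ∈ B

end

/-- `B` is complete for the class `Γ` of sets of natural numbers: `B` belongs to `Γ`, and every
member of `Γ` is many-one reducible to `B`. -/
def IsComplete (Γ : Set ℕ → Prop) (B : Set ℕ) : Prop :=
  Γ B ∧ ∀ A : Set ℕ, Γ A →
    ∃ f : ℕ → ℕ, Computable f ∧ ∀ i, i ∈ A ↔ f i ∈ B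

/-- `B` is complete for `Γ` relative to (or within) `C`: `B` is the intersection of `C` with a
member of `Γ`, and every member of `Γ` is many-one reducible to `B` by a computable function all of
whose values are in `C`. -/
def IsCompleteRelativeTo (Γ : Set ℕ → Prop) (C B : Set ℕ) : Prop :=
  (∃ R : Set ℕ, Γ R ∧ B = C ∩ R) ∧ ∀ A : Set ℕ, Γ A →
    ∃ f : ℕ → ℕ, Computable f ∧ (∀ i, f i ∈ C) ∧ ∀ i, i ∈ A ↔ f i ∈ B

/-! ### Equivalence structures and weak ultrahomogeneity -/

/-- The only symbol of the language of equivalence structures is a binary relation symbol. -/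
inductive EqSymbol : ℕ → Type
  | equiv : EqSymbol 2

/-- The first-order language of equivalence structures. -/
def eqLanguage : Language where
  Functions := fun _ => Empty
  Relations := EqSymbol

/-- The equivalence structure `(M, s)` given by an equivalence relation `s` on `M`. -/
@[reducible]
def eqStructure {M : Type*} (s : Setoid M) : eqLanguage.Structure M where
  funMap := fun f _ => f.elim
  RelMap := fun R => match R with
    | EqSymbol.equiv => fun x => s (x 0) (x 1)

/-- A structure is weakly ultrahomogeneous if it has a finite (exceptional) set of elements such
that it becomes ultrahomogeneous when constants naming these elements are added. -/
def IsWeaklyUltrahomogeneous (L : Language) (M : Type*) [L.Structure M] : Prop :=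
  ∃ S : Set M, S.Finite ∧ (L.withConstants S).IsUltrahomogeneous M

/-! ### Index sets -/

/-- The standard enumeration of the partial computable functions. -/
def phi (e : ℕ) : ℕ →. ℕ :=
  (Denumerable.ofNat Nat.Partrec.Code e).eval

/-- `φ_e` is total and is the characteristic function of the relation `s` on `ℕ`. -/
def IsIndexOf (e : ℕ) (s : Setoid ℕ) : Prop :=
  ∀ x y : ℕ, (s x y → 1 ∈ phi e (Nat.pair x y)) ∧ (¬ s x y → 0 ∈ phi e (Nat.pair x y))

/-- The set of indices of computable equivalence structures `(ℕ, ≡)`. -/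
def EQ : Set ℕ :=
  {e | ∃ s : Setoid ℕ, IsIndexOf e s}

/-- The set of indices of computable ultrahomogeneous equivalence structures. -/
def UHQ : Set ℕ :=
  {e | ∃ s : Setoid ℕ, IsIndexOf e s ∧
    letI := eqStructure s
    eqLanguage.IsUltrahomogeneous ℕ}

/-- The set of indices of computable weakly ultrahomogeneous equivalence structures. -/
def WUQ : Set ℕ :=
  {e | ∃ s : Setoid ℕ, IsIndexOf e s ∧
    letI := eqStructure s
    IsWeaklyUltrahomogeneous eqLanguage ℕ}

end EqIndex

-- With constants for a finite set S, an equivalence structure is ultrahomogeneous iff all classes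
-- missing S have the same size. If x and y lie in such classes, fixing S and sending x to y is a
-- finite partial isomorphism, so its extension compares the two classes. Conversely, a finite
-- partial isomorphism fixing S extends first to a permutation of the classes, then class by class
-- (`EquinumerousOff.exists_equiv_extending`). Enlarging S preserves the condition, so weak
-- ultrahomogeneity asks for one N such that S = {0, ..., N-1} works.
--
-- For fixed N the condition is Π⁰₂: every finite part of the class of x must be matched by a finite
-- part of the class of y, and being an index is absorbed into the same ∀∃ form
-- (`exists_isIndexOf_equinumerousOff_iff`). N = 0 gives UHQ, and ∃ N gives WUQ.
--
-- For hardness, a Π⁰₂ set has the form "Q i k for infinitely many k" (`IsPi.exists_infinite_iff`).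
-- `twoClasses` gives each a two classes: a padded copy of the hits of P a, and its complement,
-- which is always infinite. They have the same size iff there are infinitely many hits. For UHQ
-- every P a is Q i. For a Σ⁰₃ set ∃ b, ⟨i, b⟩ ∈ B, P a collects the hits of all b ≤ a: a witness b
-- makes all classes with a ≥ b infinite, and without a witness unequal pairs occur beyond every
-- finite set of constants.

namespace EqIndex

/-! ### Extending finite partial automorphisms of an equivalence relation -/

/-- All the classes of `s` which do not meet `S` have the same size. -/
def EquinumerousOff (s : Setoid ℕ) (S : Set ℕ) : Prop :=
  ∀ x y : ℕ, (∀ a ∈ S, ¬ s a x) → (∀ a ∈ S, ¬ s a y) →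
    {z | s x z}.encard ≤ {z | s y z}.encard

theorem EquinumerousOff.mono {s : Setoid ℕ} {S T : Set ℕ} (h : EquinumerousOff s S)
    (hST : S ⊆ T) : EquinumerousOff s T :=
  fun x y hx hy => h x y (fun a ha => hx a (hST ha)) (fun a ha => hy a (hST ha))

/-- An injection from a finite part of `α` to an equinumerous type extends to a bijection. -/
theorem exists_equiv_extending_of_finite {α β : Type} (F : Set α) (hF : F.Finite) (f : F → β)
    (hf : Function.Injective f) (h : Nonempty (α ≃ β)) : ∃ g : α ≃ β, ∀ x : F, g x = f x := by
  cases finite_or_infinite α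
  · exact Cardinal.extend_function_finite ⟨f, hf⟩ h
  · refine Cardinal.extend_function_of_lt ⟨f, hf⟩ ?_ h
    exact (Cardinal.lt_aleph0_iff_set_finite.2 hF).trans_le (Cardinal.aleph0_le_mk α)

theorem nonempty_equiv_of_encard_eq {S T : Set ℕ} (h : S.encard = T.encard) :
    Nonempty (S ≃ T) := by
  rcases S.finite_or_infinite with hS | hS
  · have hT : T.Finite := by
      rw [← Set.encard_lt_top_iff, ← h]; exact hS.encard_lt_top
    have := hS.to_subtype
    have := hT.to_subtype
    exact Finite.card_eq.1 (congrArg ENat.toNat h)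
  · have hT : T.Infinite := by
      rw [← Set.encard_eq_top_iff, ← h]; exact hS.encard_eq
    have := hS.to_subtype
    have := hT.to_subtype
    exact nonempty_equiv_of_countable

/-- The map f induces an injection on the finitely many classes meeting F, which extends to a
permutation σ of all classes. Each class c is as large as σ c, so f restricted to c extends to a
bijection from c to σ c, and these bijections are glued. -/
theorem EquinumerousOff.exists_equiv_extending {s : Setoid ℕ} {S : Set ℕ}
    (h : EquinumerousOff s S) {F : Set ℕ} (hF : F.Finite) (hSF : S ⊆ F) (f : F → ℕ)
    (hinj : Function.Injective f) (hrel : ∀ x y : F, s (f x) (f y) ↔ s x y)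
    (hfix : ∀ x : F, (x : ℕ) ∈ S → f x = x) :
    ∃ g : ℕ ≃ ℕ, (∀ x y, s (g x) (g y) ↔ s x y) ∧ ∀ x : F, g x = f x := by
  let q : ℕ → Quotient s := fun x => Quotient.mk s x
  have hq : ∀ {x y}, q x = q y ↔ s x y := fun {x y} => Quotient.eq
  let C : Set (Quotient s) := q '' F
  have hC : C.Finite := hF.image q
  choose p hpF hp using fun c : C => c.2
  have hpq : ∀ x : F, ∀ hx : q x ∈ C, q (f ⟨p ⟨q x, hx⟩, hpF _⟩) = q (f x) := by
    intro x hx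
    rw [hq, hrel, ← hq]
    exact hp ⟨q x, hx⟩
  let σ₀ : C → Quotient s := fun c => q (f ⟨p c, hpF c⟩)
  have hσ₀ : Function.Injective σ₀ := by
    intro c d hcd
    have := (hrel _ _).1 (hq.1 hcd)
    apply Subtype.ext
    rw [← hp c, ← hp d]
    exact hq.2 this
  obtain ⟨σ, hσ⟩ := exists_equiv_extending_of_finite C hC σ₀ hσ₀ ⟨Equiv.refl _⟩
  have hσf : ∀ x : F, σ (q x) = q (f x) := by
    intro x
    have hx : q x ∈ C := ⟨x, x.2, rfl⟩
    exact (hσ ⟨q x, hx⟩).trans (hpq x hx)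
  have hσS : ∀ a ∈ S, σ (q a) = q a := by
    intro a ha
    rw [hσf ⟨a, hSF ha⟩, hfix ⟨a, hSF ha⟩ ha]
  -- A class meeting S is fixed by σ. As σ is injective, any other class is sent to one missing S,
  -- where all sizes agree.
  have hcard : ∀ c : Quotient s, {x | q x = c}.encard = {x | q x = σ c}.encard := by
    intro c
    by_cases hc : ∃ a ∈ S, q a = c
    · obtain ⟨a, ha, rfl⟩ := hc
      rw [hσS a ha]
    · have hd : ¬ ∃ a ∈ S, q a = σ c := by
        rintro ⟨a, ha, hac⟩
        exact hc ⟨a, ha, σ.injective ((hσS a ha).trans hac)⟩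
      obtain ⟨x, hx⟩ := Quotient.exists_rep c
      obtain ⟨y, hy⟩ := Quotient.exists_rep (σ c)
      have hx' : {z | q z = c} = {z | s x z} := by
        ext z
        change q z = c ↔ s x z
        rw [← hx, eq_comm]; exact hq
      have hy' : {z | q z = σ c} = {z | s y z} := by
        ext z
        change q z = σ c ↔ s y z
        rw [← hy, eq_comm]; exact hq
      have hxS : ∀ a ∈ S, ¬ s a x := fun a ha hax => hc ⟨a, ha, (hq.2 hax).trans hx⟩
      have hyS : ∀ a ∈ S, ¬ s a y := fun a ha hay => hd ⟨a, ha, (hq.2 hay).trans hy⟩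
      rw [hx', hy']
      exact le_antisymm (h x y hxS hyS) (h y x hyS hxS)
  have hfib : ∀ c : Quotient s, ∃ g : {x // q x = c} ≃ {x // q x = σ c},
      ∀ x : {x // q x = c}, ∀ hx : (x : ℕ) ∈ F, (g x : ℕ) = f ⟨x, hx⟩ := by
    intro c
    obtain ⟨g, hg⟩ := exists_equiv_extending_of_finite (α := {x // q x = c})
      (β := {x // q x = σ c}) {x | (x : ℕ) ∈ F} (hF.preimage Subtype.val_injective.injOn)
      (fun x => ⟨f ⟨x.1, x.2⟩, by rw [← hσf, x.1.2]⟩)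
      (fun x y hxy => by
        have : (x.1 : ℕ) = y.1 := Subtype.mk.inj (hinj (congrArg Subtype.val hxy))
        exact Subtype.ext (Subtype.ext this))
      (nonempty_equiv_of_encard_eq (hcard c))
    exact ⟨g, fun x hx => congrArg Subtype.val (hg ⟨x, hx⟩)⟩
  choose g hg using hfib
  let G : ℕ ≃ ℕ := (Equiv.sigmaFiberEquiv q).symm.trans
    ((Equiv.sigmaCongr σ g).trans (Equiv.sigmaFiberEquiv q))
  have hG : ∀ x, G x = (g (q x) ⟨x, rfl⟩ : ℕ) := fun x => rfl
  have hGq : ∀ x, q (G x) = σ (q x) := fun x => by rw [hG]; exact (g (q x) ⟨x, rfl⟩).2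
  refine ⟨G, fun x y => ?_, fun x => ?_⟩
  · rw [← hq, hGq, hGq, σ.injective.eq_iff, hq]
  · rw [hG]
    exact hg (q x) ⟨x, rfl⟩ x.2

/-! ### Ultrahomogeneity of equivalence structures -/

/-- Ultrahomogeneity of an equivalence relation with constants for the elements of `S`, in any
language whose symbols denote these constants and the relation. -/
theorem isUltrahomogeneous_iff_equinumerousOff (L : Language) [L.Structure ℕ] (s : Setoid ℕ)
    {S : Set ℕ} (hS : S.Finite)
    (hfun : ∀ n (f : L.Functions n), ∃ c ∈ S, ∀ v : Fin n → ℕ, Language.Structure.funMap f v = c)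
    (hconst : ∀ c ∈ S, ∃ f : L.Functions 0, ∀ v : Fin 0 → ℕ, Language.Structure.funMap f v = c)
    (hrel : ∀ n (R : L.Relations n), ∃ i j : Fin n, ∀ v : Fin n → ℕ,
      Language.Structure.RelMap R v ↔ s (v i) (v j))
    (hequiv : ∃ R : L.Relations 2, ∀ v : Fin 2 → ℕ,
      Language.Structure.RelMap R v ↔ s (v 0) (v 1)) :
    L.IsUltrahomogeneous ℕ ↔ EquinumerousOff s S := by
  have hsub : ∀ T : L.Substructure ℕ, S ⊆ T := by
    intro T c hc
    obtain ⟨f, hf⟩ := hconst c hc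
    have := T.fun_mem f Fin.elim0 (fun i => i.elim0)
    rwa [hf] at this
  have hT : ∀ T : Set ℕ, S ⊆ T → ∃ U : L.Substructure ℕ, (U : Set ℕ) = T := by
    intro T hST
    refine ⟨⟨T, fun {n} f v _ => ?_⟩, rfl⟩
    obtain ⟨c, hc, hf⟩ := hfun n f
    rw [hf]
    exact hST hc
  have hclosure : ∀ T : Set ℕ, S ⊆ T → (Language.Substructure.closure L T : Set ℕ) = T := by
    intro T hST
    obtain ⟨U, rfl⟩ := hT T hST
    rw [Language.Substructure.closure_eq]
  constructor
  · intro hUH x y hx hy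
    classical
    have hxS : x ∉ S := fun h => hx x h (s.refl x)
    -- Test ultrahomogeneity on the embedding of S ∪ {x} that fixes S and sends x to y.
    let T := Language.Substructure.closure L (insert x S)
    have hTc : (T : Set ℕ) = insert x S := hclosure _ (Set.subset_insert x S)
    have hTmem : ∀ z : T, (z : ℕ) = x ∨ (z : ℕ) ∈ S := by
      intro z
      have : (z : ℕ) ∈ (T : Set ℕ) := z.2
      rwa [hTc] at this
    let φ : T → ℕ := fun z => if (z : ℕ) = x then y else z
    have hφx : ∀ z : T, (z : ℕ) = x → φ z = y := fun z hz => if_pos hz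
    have hφS : ∀ z : T, (z : ℕ) ∈ S → φ z = z := fun z hz =>
      if_neg (fun h : (z : ℕ) = x => hxS (h ▸ hz))
    have hφrel : ∀ z w : T, s (φ z) (φ w) ↔ s z w := by
      intro z w
      rcases hTmem z with hz | hz <;> rcases hTmem w with hw | hw
      · rw [hφx z hz, hφx w hw, hz, hw]
        exact iff_of_true (s.refl _) (s.refl _)
      · rw [hφx z hz, hφS w hw, hz]
        exact iff_of_false (fun h => hy _ hw (s.symm h)) (fun h => hx _ hw (s.symm h))
      · rw [hφS z hz, hφx w hw, hw]
        exact iff_of_false (hy _ hz) (hx _ hz)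
      · rw [hφS z hz, hφS w hw]
    have hφinj : Function.Injective φ := by
      intro z w hzw
      have hs : s z w := (hφrel z w).1 (hzw ▸ s.refl _)
      apply Subtype.ext
      rcases hTmem z with hz | hz <;> rcases hTmem w with hw | hw
      · rw [hz, hw]
      · exact absurd (hz ▸ s.symm hs) (hx _ hw)
      · exact absurd (hw ▸ hs) (hx _ hz)
      · rwa [hφS z hz, hφS w hw] at hzw
    let Φ : T ↪[L] ℕ :=
      { toFun := φ
        inj' := hφinj
        map_fun' := by
          intro n f v
          obtain ⟨c, hc, hf⟩ := hfun n f
          have h1 : ((Language.Structure.funMap f v : T) : ℕ) = c := hf _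
          change φ _ = _
          rw [hf, hφS _ (h1 ▸ hc), h1]
        map_rel' := by
          intro n R v
          obtain ⟨i, j, hR⟩ := hrel n R
          rw [hR]
          exact (hφrel (v i) (v j)).trans (hR (fun k => (v k : ℕ))).symm }
    obtain ⟨g, hg⟩ := hUH T ⟨(hS.insert x).toFinset, by simp [T]⟩ Φ
    have hxT : x ∈ T := by
      change x ∈ (T : Set ℕ)
      rw [hTc]
      exact Set.mem_insert x S
    have hgx : g x = y := by
      have h1 := congrArg (fun F : T ↪[L] ℕ => F ⟨x, hxT⟩) hg
      have h2 : Φ ⟨x, hxT⟩ = y := hφx ⟨x, hxT⟩ rfl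
      exact h1.symm.trans h2
    have hgrel : ∀ a b, s (g a) (g b) ↔ s a b := by
      intro a b
      obtain ⟨R, hR⟩ := hequiv
      have h1 := g.map_rel R ![a, b]
      rw [hR, hR] at h1
      simpa using h1
    -- The automorphism maps the class of x injectively into the class of y.
    rw [← g.injective.encard_image {z | s x z}]
    apply Set.encard_le_encard
    rintro _ ⟨z, hz, rfl⟩
    change s y (g z)
    rw [← hgx, hgrel]
    exact hz
  · intro hE T hTfg f
    -- Function symbols only name elements of S, so generators add nothing beyond themselves and S.
    have hTfin : (T : Set ℕ).Finite := by
      obtain ⟨A, hA⟩ := hTfg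
      have h1 : Language.Substructure.closure L ((A : Set ℕ) ∪ S) = T := by
        rw [Language.Substructure.closure_union, hA]
        exact sup_eq_left.2 (Language.Substructure.closure_le.2 (hsub T))
      rw [← h1, hclosure _ Set.subset_union_right]
      exact A.finite_toSet.union hS
    have hfrel : ∀ a b : T, s (f a) (f b) ↔ s a b := by
      intro a b
      obtain ⟨R, hR⟩ := hequiv
      have h1 := f.map_rel R ![a, b]
      rw [hR] at h1
      have h2 : Language.Structure.RelMap R ![a, b] ↔ s a b := hR (fun k => (![a, b] k : ℕ))
      rw [h2] at h1
      simpa using h1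
    have hffix : ∀ a : T, (a : ℕ) ∈ S → f a = a := by
      intro a ha
      obtain ⟨c, hc⟩ := hconst a ha
      have h1 := f.map_fun c Fin.elim0
      rw [hc] at h1
      rw [← h1]
      congr 1
      apply Subtype.ext
      exact (hc (fun k => ((Fin.elim0 k : T) : ℕ))).symm
    obtain ⟨g, hgrel, hgf⟩ := hE.exists_equiv_extending hTfin (hsub T) f f.injective hfrel hffix
    refine ⟨{ toEquiv := g, map_fun' := ?_, map_rel' := ?_ }, ?_⟩
    · intro n F v
      obtain ⟨c, hc, hF⟩ := hfun n F
      rw [hF, hF]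
      change g c = c
      rw [hgf ⟨c, hsub T hc⟩]
      exact hffix ⟨c, hsub T hc⟩ hc
    · intro n R v
      obtain ⟨i, j, hR⟩ := hrel n R
      rw [hR, hR]
      exact hgrel _ _
    · ext a
      exact (hgf a).symm

theorem eqLanguage_isUltrahomogeneous_iff (s : Setoid ℕ) :
    (letI := eqStructure s; eqLanguage.IsUltrahomogeneous ℕ) ↔ EquinumerousOff s ∅ := by
  let := eqStructure s
  refine isUltrahomogeneous_iff_equinumerousOff eqLanguage s Set.finite_empty
    (fun n f => f.elim) (fun c hc => hc.elim) ?_ ⟨EqSymbol.equiv, fun v => Iff.rfl⟩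
  rintro n ⟨⟩
  exact ⟨0, 1, fun v => Iff.rfl⟩

theorem eqLanguage_withConstants_isUltrahomogeneous_iff (s : Setoid ℕ) {S : Set ℕ}
    (hS : S.Finite) :
    (letI := eqStructure s; (eqLanguage.withConstants S).IsUltrahomogeneous ℕ) ↔
      EquinumerousOff s S := by
  let := eqStructure s
  refine isUltrahomogeneous_iff_equinumerousOff (eqLanguage.withConstants S) s hS
    ?_ ?_ ?_ ⟨Sum.inl EqSymbol.equiv, fun v => Iff.rfl⟩
  · rintro n (f | f)
    · exact f.elim
    · cases n with
      | zero => exact ⟨_, Subtype.mem (show S from f), fun v => rfl⟩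
      | succ n => exact PEmpty.elim f
  · intro c hc
    exact ⟨Sum.inr (⟨c, hc⟩ : S), fun v => rfl⟩
  · rintro n (⟨⟨⟩⟩ | R)
    · exact ⟨0, 1, fun v => Iff.rfl⟩
    · exact Empty.elim R

theorem eqLanguage_isWeaklyUltrahomogeneous_iff (s : Setoid ℕ) :
    (letI := eqStructure s; IsWeaklyUltrahomogeneous eqLanguage ℕ) ↔
      ∃ N, EquinumerousOff s (Set.Iio N) := by
  constructor
  · rintro ⟨S, hS, h⟩
    rw [eqLanguage_withConstants_isUltrahomogeneous_iff s hS] at h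
    obtain ⟨N, hN⟩ := hS.bddAbove
    exact ⟨N + 1, h.mono fun a ha => Nat.lt_succ_of_le (hN ha)⟩
  · rintro ⟨N, h⟩
    exact ⟨Set.Iio N, Set.finite_Iio N,
      (eqLanguage_withConstants_isUltrahomogeneous_iff s (Set.finite_Iio N)).2 h⟩


/-! ### Normal forms for the arithmetical classes -/

theorem primrecPred_forall_lt {α : Type*} [Primcodable α] {p : α → ℕ → Prop} {n : α → ℕ}
    (hp : PrimrecPred fun q : α × ℕ => p q.1 q.2) (hn : Primrec n) :
    PrimrecPred fun a => ∀ x < n a, p a x := by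
  have h : PrimrecRel fun (x : ℕ) (a : α) => p a x := hp.comp (Primrec.snd.pair Primrec.fst)
  exact (h.forall_mem_list.comp (Primrec.list_range.comp hn) Primrec.id).of_eq (by simp)

theorem primrecPred_exists_lt {α : Type*} [Primcodable α] {p : α → ℕ → Prop} {n : α → ℕ}
    (hp : PrimrecPred fun q : α × ℕ => p q.1 q.2) (hn : Primrec n) :
    PrimrecPred fun a => ∃ x < n a, p a x := by
  have h : PrimrecRel fun (x : ℕ) (a : α) => p a x := hp.comp (Primrec.snd.pair Primrec.fst)
  exact (h.exists_mem_list.comp (Primrec.list_range.comp hn) Primrec.id).of_eq (by simp)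

theorem isPi_two_of_primrecPred {R : ℕ → ℕ → ℕ → Prop}
    (hR : PrimrecPred fun p : ℕ × ℕ × ℕ => R p.1 p.2.1 p.2.2) :
    IsPi 2 {i | ∀ x, ∃ y, R i x y} := by
  refine ⟨{w | ∃ y, R w.unpair.1 w.unpair.2 y}, ?_, fun i => by simp⟩
  refine ⟨{w | R w.unpair.1.unpair.1 w.unpair.1.unpair.2 w.unpair.2}, ?_, fun i => by simp⟩
  have h1 : Primrec fun w : ℕ => w.unpair.1 := Primrec.fst.comp Primrec.unpair
  have h2 : Primrec fun w : ℕ => w.unpair.2 := Primrec.snd.comp Primrec.unpair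
  exact (hR.comp ((h1.comp h1).pair ((h2.comp h1).pair h2))).computablePred

theorem exists_code_of_computablePred {C : Set ℕ} (hC : ComputablePred fun x => x ∈ C) :
    ∃ c : Nat.Partrec.Code, ∀ x, x ∈ C ↔ 1 ∈ c.eval x := by
  obtain ⟨hdec, hC⟩ := hC
  have h : Computable fun x => cond (decide (x ∈ C)) 1 0 :=
    Computable.cond hC (Computable.const 1) (Computable.const 0)
  obtain ⟨c, hc⟩ := Nat.Partrec.Code.exists_code.1 (Partrec.nat_iff.1 h)
  refine ⟨c, fun x => ?_⟩
  rw [hc]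
  by_cases hx : x ∈ C <;> simp [hx]

/-- The computable matrix becomes primitive recursive by moving its running time into the
existential witness: k codes a step bound together with y. -/
theorem IsPi.exists_primrecPred {A : Set ℕ} (hA : IsPi 2 A) :
    ∃ R : ℕ → ℕ → ℕ → Prop, PrimrecPred (fun p : ℕ × ℕ × ℕ => R p.1 p.2.1 p.2.2) ∧
      ∀ i, i ∈ A ↔ ∀ x, ∃ y, R i x y := by
  obtain ⟨B, ⟨C, hC, hBC⟩, hAB⟩ := hA
  obtain ⟨c, hc⟩ := exists_code_of_computablePred hC
  refine ⟨fun i x k => c.evaln k.unpair.1 (Nat.pair (Nat.pair i x) k.unpair.2) = some 1,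
    ?_, fun i => ?_⟩
  · refine Primrec.eq.comp ?_ (Primrec.const (some 1))
    have h3 : Primrec fun p : ℕ × ℕ × ℕ => p.2.2.unpair :=
      Primrec.unpair.comp (Primrec.snd.comp Primrec.snd)
    exact Nat.Partrec.Code.primrec_evaln.comp
      (((Primrec.fst.comp h3).pair (Primrec.const c)).pair
        (Primrec₂.natPair.comp
          (Primrec₂.natPair.comp Primrec.fst (Primrec.fst.comp Primrec.snd))
          (Primrec.snd.comp h3)))
  · rw [hAB]
    refine forall_congr' fun x => ?_
    rw [hBC]
    constructor
    · rintro ⟨y, hy⟩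
      obtain ⟨t, ht⟩ := Nat.Partrec.Code.evaln_complete.1 ((hc _).1 hy)
      exact ⟨Nat.pair t y, by simpa using ht⟩
    · rintro ⟨k, hk⟩
      exact ⟨k.unpair.2, (hc _).2 (Nat.Partrec.Code.evaln_sound hk)⟩

/-! ### Membership of the index sets in their classes -/

/-- The value `φ_e ⟨x, y⟩`, if the computation halts within `t` steps. -/
def evalWithin (t e x y : ℕ) : Option ℕ :=
  (Denumerable.ofNat Nat.Partrec.Code e).evaln t (Nat.pair x y)

/-- The number of `a < n` for which `φ_e ⟨x, a⟩ = 1` is seen within `t` steps. -/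
def countWithin (t e x n : ℕ) : ℕ :=
  ((List.range n).filter fun a => evalWithin t e x a = some 1).length

/-- Computations of at most `t` steps confirm that `φ_e` behaves as an equivalence relation
on `x, y, z`, and that `y` has at least as many equivalents as `x` has below `z`, unless `x` or `y`
is equivalent to a number below `N`. -/
def ConfirmedWithin (t e N x y z : ℕ) : Prop :=
  (evalWithin t e x x = some 1 ∧
    (evalWithin t e x y = some 0 ∧ evalWithin t e y x = some 0 ∨
      evalWithin t e x y = some 1 ∧ evalWithin t e y x = some 1) ∧
    (evalWithin t e x y = some 0 ∨ evalWithin t e y z = some 0 ∨ evalWithin t e x z = some 1)) ∧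
  ((∃ a < N, evalWithin t e a x = some 1) ∨ (∃ a < N, evalWithin t e a y = some 1) ∨
    ((∀ a < z, evalWithin t e x a = some 0 ∨ evalWithin t e x a = some 1) ∧
      countWithin t e x z ≤ countWithin t e y t))

section Primrec

variable {α : Type*} [Primcodable α] {t e N x y z : α → ℕ}

theorem primrec_evalWithin (ht : Primrec t) (he : Primrec e) (hx : Primrec x) (hy : Primrec y) :
    Primrec fun a => evalWithin (t a) (e a) (x a) (y a) :=
  Nat.Partrec.Code.primrec_evaln.comp
    ((ht.pair ((Primrec.ofNat _).comp he)).pair (Primrec₂.natPair.comp hx hy))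

theorem primrec_countWithin (ht : Primrec t) (he : Primrec e) (hx : Primrec x)
    (hy : Primrec y) : Primrec fun a => countWithin (t a) (e a) (x a) (y a) := by
  have h : PrimrecRel fun (b : ℕ) (a : α) => evalWithin (t a) (e a) (x a) b = some 1 :=
    Primrec.eq.comp (primrec_evalWithin (ht.comp Primrec.snd) (he.comp Primrec.snd)
      (hx.comp Primrec.snd) Primrec.fst) (Primrec.const _)
  exact Primrec.list_length.comp (h.listFilter.comp (Primrec.list_range.comp hy) Primrec.id)

theorem primrecPred_evalWithin_eq (v : ℕ) (ht : Primrec t) (he : Primrec e) (hx : Primrec x)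
    (hy : Primrec y) : PrimrecPred fun a => evalWithin (t a) (e a) (x a) (y a) = some v :=
  Primrec.eq.comp (primrec_evalWithin ht he hx hy) (Primrec.const _)

theorem primrecPred_confirmedWithin (ht : Primrec t) (he : Primrec e) (hN : Primrec N)
    (hx : Primrec x) (hy : Primrec y) (hz : Primrec z) :
    PrimrecPred fun a => ConfirmedWithin (t a) (e a) (N a) (x a) (y a) (z a) := by
  have hE := @primrecPred_evalWithin_eq α _ t e
  have hE' := @primrecPred_evalWithin_eq (α × ℕ) _ (fun q => t q.1) (fun q => e q.1)
  have ht' := ht.comp (Primrec.fst (α := α) (β := ℕ))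
  have he' := he.comp (Primrec.fst (α := α) (β := ℕ))
  have hx' := hx.comp (Primrec.fst (α := α) (β := ℕ))
  have hy' := hy.comp (Primrec.fst (α := α) (β := ℕ))
  have hs := Primrec.snd (α := α) (β := ℕ)
  refine PrimrecPred.and (PrimrecPred.and (hE 1 ht he hx hx) (PrimrecPred.and
    (PrimrecPred.or (PrimrecPred.and (hE 0 ht he hx hy) (hE 0 ht he hy hx))
      (PrimrecPred.and (hE 1 ht he hx hy) (hE 1 ht he hy hx)))
    (PrimrecPred.or (hE 0 ht he hx hy) (PrimrecPred.or (hE 0 ht he hy hz) (hE 1 ht he hx hz)))))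
    (PrimrecPred.or ?_ (PrimrecPred.or ?_ (PrimrecPred.and ?_ ?_)))
  · exact primrecPred_exists_lt (hE' 1 ht' he' hs hx') hN
  · exact primrecPred_exists_lt (hE' 1 ht' he' hs hy') hN
  · exact primrecPred_forall_lt (PrimrecPred.or (hE' 0 ht' he' hx' hs) (hE' 1 ht' he' hx' hs)) hz
  · exact Primrec.nat_le.comp (primrec_countWithin ht he hx hz) (primrec_countWithin ht he hy ht)

end Primrec

-- Bounded computations and the classes they reveal

theorem countWithin_eq_card (t e x n : ℕ) :
    countWithin t e x n = {a ∈ Finset.range n | evalWithin t e x a = some 1}.card := rfl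

theorem mem_phi_of_evalWithin {t e x y v : ℕ} (h : evalWithin t e x y = some v) :
    v ∈ phi e (Nat.pair x y) :=
  Nat.Partrec.Code.evaln_sound h

theorem IsIndexOf.one_mem_iff {e : ℕ} {s : Setoid ℕ} (h : IsIndexOf e s) {x y : ℕ} :
    1 ∈ phi e (Nat.pair x y) ↔ s x y := by
  refine ⟨fun h1 => by_contra fun hs => ?_, (h x y).1⟩
  exact one_ne_zero (Part.mem_unique h1 ((h x y).2 hs))

theorem IsIndexOf.zero_mem_iff {e : ℕ} {s : Setoid ℕ} (h : IsIndexOf e s) {x y : ℕ} :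
    0 ∈ phi e (Nat.pair x y) ↔ ¬ s x y := by
  refine ⟨fun h1 hs => ?_, (h x y).2⟩
  exact zero_ne_one (Part.mem_unique h1 ((h x y).1 hs))

theorem IsIndexOf.unique {e : ℕ} {s s' : Setoid ℕ} (h : IsIndexOf e s) (h' : IsIndexOf e s') :
    s = s' :=
  Setoid.ext fun _ _ => h.one_mem_iff.symm.trans h'.one_mem_iff

/-- All computations with inputs below `n` halt in some common number of steps. -/
theorem IsIndexOf.exists_evalWithin {e : ℕ} {s : Setoid ℕ} (h : IsIndexOf e s) (n : ℕ) :
    ∃ t ≥ n, ∀ x < n, ∀ y < n, (evalWithin t e x y = some 1 ↔ s x y) ∧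
      (evalWithin t e x y = some 0 ↔ ¬ s x y) := by
  have hv : ∀ p : ℕ × ℕ, ∃ t, ∀ t' ≥ t, (evalWithin t' e p.1 p.2 = some 1 ↔ s p.1 p.2) ∧
      (evalWithin t' e p.1 p.2 = some 0 ↔ ¬ s p.1 p.2) := by
    intro p
    by_cases hs : s p.1 p.2
    · obtain ⟨t, ht⟩ := Nat.Partrec.Code.evaln_complete.1 ((h p.1 p.2).1 hs)
      refine ⟨t, fun t' htt => ?_⟩
      have : evalWithin t' e p.1 p.2 = some 1 := Nat.Partrec.Code.evaln_mono htt ht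
      simp [this, hs]
    · obtain ⟨t, ht⟩ := Nat.Partrec.Code.evaln_complete.1 ((h p.1 p.2).2 hs)
      refine ⟨t, fun t' htt => ?_⟩
      have : evalWithin t' e p.1 p.2 = some 0 := Nat.Partrec.Code.evaln_mono htt ht
      simp [this, hs]
  choose t ht using hv
  refine ⟨n + (Finset.range n ×ˢ Finset.range n).sup t, Nat.le_add_right _ _, fun x hx y hy => ?_⟩
  refine ht (x, y) _ (le_trans ?_ (Nat.le_add_left _ _))
  exact Finset.le_sup (f := t) (by simp [hx, hy])

/-- A set with at least `k` elements has at least `k` elements below some bound. -/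
theorem exists_le_card_filter_range {X : Set ℕ} [DecidablePred (· ∈ X)] {k : ℕ}
    (h : (k : ℕ∞) ≤ X.encard) : ∃ M, k ≤ {a ∈ Finset.range M | a ∈ X}.card := by
  obtain ⟨Y, hYX, hY⟩ := Set.exists_subset_encard_eq h
  have hfin : Y.Finite := Set.finite_of_encard_eq_coe hY
  obtain ⟨M, hM⟩ := hfin.bddAbove
  refine ⟨M + 1, ?_⟩
  rw [← ENat.natCast_le_natCast, ← hY, ← Set.encard_coe_eq_coe_finsetCard]
  refine Set.encard_le_encard fun a ha => ?_
  simpa using ⟨hM ha, hYX ha⟩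

/-- Cardinalities up to ℵ₀ are compared through finite parts. The confirmations over all x, y, z
also force totality, values 0 or 1, and the equivalence axioms, so no separate condition on e is
needed. -/
theorem exists_isIndexOf_equinumerousOff_iff (e N : ℕ) :
    (∃ s, IsIndexOf e s ∧ EquinumerousOff s (Set.Iio N)) ↔
      ∀ x y z, ∃ t, ConfirmedWithin t e N x y z := by
  classical
  constructor
  · rintro ⟨s, hs, hE⟩ x y z
    obtain ⟨M, hM⟩ : ∃ M, (∃ a < N, s a x) ∨ (∃ a < N, s a y) ∨
        {a ∈ Finset.range z | s x a}.card ≤ {a ∈ Finset.range M | s y a}.card := by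
      by_cases hx : ∃ a < N, s a x
      · exact ⟨0, Or.inl hx⟩
      by_cases hy : ∃ a < N, s a y
      · exact ⟨0, Or.inr (Or.inl hy)⟩
      have h1 := hE x y (fun a ha h => hx ⟨a, ha, h⟩) (fun a ha h => hy ⟨a, ha, h⟩)
      have h2 : (({a ∈ Finset.range z | s x a}.card : ℕ) : ℕ∞) ≤ {a | s x a}.encard := by
        rw [← Set.encard_coe_eq_coe_finsetCard]
        exact Set.encard_le_encard fun a ha => (Finset.mem_filter.1 ha).2
      obtain ⟨M, hM⟩ := exists_le_card_filter_range (h2.trans h1)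
      exact ⟨M, Or.inr (Or.inr hM)⟩
    -- The bound t also limits the search in the class of y, so it must be at least M.
    obtain ⟨t, htn, ht⟩ := hs.exists_evalWithin (x + y + z + N + M + 1)
    have h1 : ∀ a b, a < x + y + z + N + M + 1 → b < x + y + z + N + M + 1 → s a b →
      evalWithin t e a b = some 1 := fun a b ha hb hab => (ht a ha b hb).1.2 hab
    have h0 : ∀ a b, a < x + y + z + N + M + 1 → b < x + y + z + N + M + 1 → ¬ s a b →
      evalWithin t e a b = some 0 := fun a b ha hb hab => (ht a ha b hb).2.2 hab
    refine ⟨t, ⟨h1 x x (by omega) (by omega) (s.refl x), ?_, ?_⟩, ?_⟩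
    · by_cases hxy : s x y
      · exact Or.inr ⟨h1 _ _ (by omega) (by omega) hxy,
          h1 _ _ (by omega) (by omega) (s.symm hxy)⟩
      · exact Or.inl ⟨h0 _ _ (by omega) (by omega) hxy,
          h0 _ _ (by omega) (by omega) fun h => hxy (s.symm h)⟩
    · by_cases hxy : s x y
      · by_cases hyz : s y z
        · exact Or.inr (Or.inr (h1 _ _ (by omega) (by omega) (s.trans hxy hyz)))
        · exact Or.inr (Or.inl (h0 _ _ (by omega) (by omega) hyz))
      · exact Or.inl (h0 _ _ (by omega) (by omega) hxy)
    · rcases hM with ⟨a, ha, hax⟩ | ⟨a, ha, hay⟩ | hM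
      · exact Or.inl ⟨a, ha, h1 _ _ (by omega) (by omega) hax⟩
      · exact Or.inr (Or.inl ⟨a, ha, h1 _ _ (by omega) (by omega) hay⟩)
      · refine Or.inr (Or.inr ⟨fun a ha => ?_, ?_⟩)
        · by_cases hxa : s x a
          · exact Or.inr (h1 _ _ (by omega) (by omega) hxa)
          · exact Or.inl (h0 _ _ (by omega) (by omega) hxa)
        · rw [countWithin_eq_card, countWithin_eq_card]
          refine (Finset.card_le_card ?_).trans (hM.trans (Finset.card_le_card ?_))
          · intro a ha
            rw [Finset.mem_filter, Finset.mem_range] at ha ⊢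
            exact ⟨ha.1, (ht x (by omega) a (by omega)).1.1 ha.2⟩
          · intro a ha
            rw [Finset.mem_filter, Finset.mem_range] at ha ⊢
            exact ⟨by omega, h1 y a (by omega) (by omega) ha.2⟩
  · intro h
    have hex : ∀ x y, 0 ∈ phi e (Nat.pair x y) ∧ 0 ∈ phi e (Nat.pair y x) ∨
        1 ∈ phi e (Nat.pair x y) ∧ 1 ∈ phi e (Nat.pair y x) := fun x y => by
      obtain ⟨t, ⟨-, h2, -⟩, -⟩ := h x y 0
      exact h2.imp (And.imp mem_phi_of_evalWithin mem_phi_of_evalWithin)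
        (And.imp mem_phi_of_evalWithin mem_phi_of_evalWithin)
    have hnot : ∀ {x y}, 0 ∈ phi e (Nat.pair x y) → ¬ 1 ∈ phi e (Nat.pair x y) :=
      fun h0 h1 => zero_ne_one (Part.mem_unique h0 h1)
    let s : Setoid ℕ :=
      { r := fun x y => 1 ∈ phi e (Nat.pair x y)
        iseqv :=
          { refl := fun x => by
              obtain ⟨t, ⟨h1, -⟩, -⟩ := h x x 0
              exact mem_phi_of_evalWithin h1
            symm := fun {x y} hxy => by
              rcases hex x y with h0 | h1
              · exact absurd hxy (hnot h0.1)
              · exact h1.2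
            trans := fun {x y z} hxy hyz => by
              obtain ⟨t, ⟨-, -, h3⟩, -⟩ := h x y z
              rcases h3 with h3 | h3 | h3
              · exact absurd hxy (hnot (mem_phi_of_evalWithin h3))
              · exact absurd hyz (hnot (mem_phi_of_evalWithin h3))
              · exact mem_phi_of_evalWithin h3 } }
    have hs : IsIndexOf e s := fun x y => ⟨id, fun hxy => by
      rcases hex x y with h0 | h1
      · exact h0.1
      · exact absurd h1.1 hxy⟩
    refine ⟨s, hs, fun x y hx hy => ?_⟩
    have hcount : ∀ z, {a ∈ Finset.range z | s x a}.card ≤ {a | s y a}.encard := by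
      intro z
      obtain ⟨t, -, ht⟩ := h x y z
      rcases ht with ⟨a, ha, hax⟩ | ⟨a, ha, hay⟩ | ⟨h1, h2⟩
      · exact absurd (mem_phi_of_evalWithin hax) (hx a ha)
      · exact absurd (mem_phi_of_evalWithin hay) (hy a ha)
      -- All values below z are decided by time t, so the class of x is not undercounted; for y an
      -- undercount is harmless.
      · have h3 : {a ∈ Finset.range z | s x a}.card ≤ countWithin t e x z := by
          rw [countWithin_eq_card]
          refine Finset.card_le_card fun a ha => ?_
          rw [Finset.mem_filter, Finset.mem_range] at ha ⊢
          refine ⟨ha.1, (h1 a ha.1).resolve_left fun h0 => ?_⟩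
          exact hnot (mem_phi_of_evalWithin h0) ha.2
        have h4 : (countWithin t e y t : ℕ∞) ≤ {a | s y a}.encard := by
          rw [countWithin_eq_card, ← Set.encard_coe_eq_coe_finsetCard]
          exact Set.encard_le_encard fun a ha => mem_phi_of_evalWithin (Finset.mem_filter.1 ha).2
        exact (ENat.natCast_le_natCast.2 (h3.trans h2)).trans h4
    refine ENat.forall_natCast_le_iff_le.1 fun k hk => ?_
    obtain ⟨z, hz⟩ := exists_le_card_filter_range hk
    exact (ENat.natCast_le_natCast.2 hz).trans (hcount z)

theorem mem_UHQ_iff (e : ℕ) :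
    e ∈ UHQ ↔ ∃ s, IsIndexOf e s ∧ EquinumerousOff s (Set.Iio 0) := by
  have h0 : Set.Iio 0 = (∅ : Set ℕ) := by ext; simp
  rw [h0]
  exact exists_congr fun s => and_congr_right fun _ => eqLanguage_isUltrahomogeneous_iff s

theorem mem_WUQ_iff (e : ℕ) :
    e ∈ WUQ ↔ ∃ N, ∃ s, IsIndexOf e s ∧ EquinumerousOff s (Set.Iio N) := by
  rw [exists_comm]
  simp only [exists_and_left]
  exact exists_congr fun s => and_congr_right fun _ => eqLanguage_isWeaklyUltrahomogeneous_iff s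

theorem isPi_two_confirmed {e N : ℕ → ℕ} (he : Primrec e) (hN : Primrec N) :
    IsPi 2 {p : ℕ | ∀ w : ℕ, ∃ t,
      ConfirmedWithin t (e p) (N p) w.unpair.1 w.unpair.2.unpair.1 w.unpair.2.unpair.2} := by
  have hw : Primrec fun p : ℕ × ℕ × ℕ => p.2.1.unpair :=
    Primrec.unpair.comp (Primrec.fst.comp Primrec.snd)
  have hw' : Primrec fun p : ℕ × ℕ × ℕ => p.2.1.unpair.2.unpair :=
    Primrec.unpair.comp (Primrec.snd.comp hw)
  exact isPi_two_of_primrecPred (primrecPred_confirmedWithin (Primrec.snd.comp Primrec.snd)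
    (he.comp Primrec.fst) (hN.comp Primrec.fst) (Primrec.fst.comp hw) (Primrec.fst.comp hw')
    (Primrec.snd.comp hw'))

theorem forall_unpair_iff {P : ℕ → ℕ → ℕ → Prop} :
    (∀ w : ℕ, P w.unpair.1 w.unpair.2.unpair.1 w.unpair.2.unpair.2) ↔ ∀ x y z, P x y z :=
  ⟨fun h x y z => by simpa using h (Nat.pair x (Nat.pair y z)), fun h _ => h _ _ _⟩

theorem isPi_two_UHQ : IsPi 2 UHQ := by
  convert isPi_two_confirmed (e := id) (N := fun _ => 0) Primrec.id (Primrec.const 0) using 1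
  ext e
  rw [mem_UHQ_iff, exists_isIndexOf_equinumerousOff_iff]
  exact forall_unpair_iff.symm

theorem isSigma_three_WUQ : IsSigma 3 WUQ := by
  refine ⟨_, isPi_two_confirmed (e := fun p => p.unpair.1) (N := fun p => p.unpair.2)
    (Primrec.fst.comp Primrec.unpair) (Primrec.snd.comp Primrec.unpair), fun e => ?_⟩
  rw [mem_WUQ_iff]
  refine exists_congr fun N => ?_
  rw [exists_isIndexOf_equinumerousOff_iff, Set.mem_ofPred_eq, Nat.unpair_pair]
  exact (forall_unpair_iff (P := fun x y z => ∃ t, ConfirmedWithin t e N x y z)).symm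

/-! ### Hardness -/

/-- Membership in a `Π⁰₂` set is equivalent to a primitive recursive relation holding infinitely
often. -/
theorem IsPi.exists_infinite_iff {A : Set ℕ} (hA : IsPi 2 A) :
    ∃ Q : ℕ → ℕ → Prop, PrimrecRel Q ∧ ∀ i, i ∈ A ↔ {k | Q i k}.Infinite := by
  obtain ⟨R, hR, hAR⟩ := hA.exists_primrecPred
  -- Q i ⟨n, m⟩ will say that m is the least bound for witnesses of all x < n, so each n contributes
  -- at most one hit.
  let D : ℕ → ℕ → ℕ → Prop := fun i n m => ∀ x < n, ∃ y < m, R i x y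
  have hD : PrimrecPred fun p : ℕ × ℕ × ℕ => D p.1 p.2.1 p.2.2 := by
    refine primrecPred_forall_lt (p := fun (p : ℕ × ℕ × ℕ) x => ∃ y < p.2.2, R p.1 x y)
      ?_ (Primrec.fst.comp Primrec.snd)
    refine primrecPred_exists_lt (p := fun (q : (ℕ × ℕ × ℕ) × ℕ) y => R q.1.1 q.2 y)
      ?_ (Primrec.snd.comp (Primrec.snd.comp Primrec.fst))
    exact hR.comp ((Primrec.fst.comp (Primrec.fst.comp Primrec.fst)).pair
      ((Primrec.snd.comp Primrec.fst).pair Primrec.snd))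
  refine ⟨fun i k => D i k.unpair.1 k.unpair.2 ∧ ∀ m < k.unpair.2, ¬ D i k.unpair.1 m,
    ?_, fun i => ?_⟩
  · have h2 : Primrec fun p : ℕ × ℕ => p.2.unpair := Primrec.unpair.comp Primrec.snd
    refine PrimrecPred.and
      (hD.comp (Primrec.fst.pair ((Primrec.fst.comp h2).pair (Primrec.snd.comp h2)))) ?_
    refine primrecPred_forall_lt (p := fun (p : ℕ × ℕ) m => ¬ D p.1 p.2.unpair.1 m)
      (PrimrecPred.not ?_) (Primrec.snd.comp h2)
    exact hD.comp ((Primrec.fst.comp Primrec.fst).pair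
      ((Primrec.fst.comp (h2.comp Primrec.fst)).pair Primrec.snd))
  · classical
    rw [hAR]
    constructor
    · intro h
      have hex : ∀ n, ∃ m, D i n m := by
        choose y hy using h
        intro n
        refine ⟨(Finset.range n).sup y + 1, fun x hx => ⟨y x, ?_, hy x⟩⟩
        exact Nat.lt_succ_of_le (Finset.le_sup (Finset.mem_range.2 hx))
      refine Set.infinite_of_injective_forall_mem (f := fun n => Nat.pair n (Nat.find (hex n)))
        (fun a b hab => (Nat.pair_eq_pair.1 hab).1) fun n => ?_
      simp only [Set.mem_ofPred_eq, Nat.unpair_pair]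
      exact ⟨Nat.find_spec (hex n), fun m hm => Nat.find_min (hex n) hm⟩
    · intro h
      by_contra! hx
      obtain ⟨x, hx⟩ := hx
      -- If x has no witness, every hit ⟨n, m⟩ has n ≤ x, and n determines m by minimality.
      refine h (Set.Finite.of_finite_image (f := fun k => k.unpair.1)
        ((Set.finite_Iic x).subset ?_) ?_)
      · rintro _ ⟨k, ⟨hk, -⟩, rfl⟩
        by_contra hlt
        obtain ⟨y, -, hy⟩ := hk x (not_le.1 hlt)
        exact hx y hy
      · rintro k ⟨hk, hk'⟩ l ⟨hl, hl'⟩ (hkl : k.unpair.1 = l.unpair.1)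
        have h2 : k.unpair.2 = l.unpair.2 := by
          rw [← hkl] at hl hl'
          exact le_antisymm (not_lt.1 fun hlt => hk' _ hlt hl) (not_lt.1 fun hlt => hl' _ hlt hk)
        rw [← Nat.pair_unpair k, ← Nat.pair_unpair l, hkl, h2]

/-- The kernels of uniformly computable functions are uniformly computable. -/
theorem exists_computable_isIndexOf_ker {K : ℕ → ℕ → ℕ} (hK : Primrec₂ K) :
    ∃ f : ℕ → ℕ, Computable f ∧ ∀ i, IsIndexOf (f i) (Setoid.ker (K i)) := by
  have h1 : Primrec fun w : ℕ => w.unpair.1 := Primrec.fst.comp Primrec.unpair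
  have h2 : Primrec fun w : ℕ => w.unpair.2 := Primrec.snd.comp Primrec.unpair
  have hg : Primrec fun w : ℕ =>
      if K w.unpair.1 w.unpair.2.unpair.1 = K w.unpair.1 w.unpair.2.unpair.2 then 1 else 0 :=
    Primrec.ite (Primrec.eq.comp (hK.comp h1 (h1.comp h2)) (hK.comp h1 (h2.comp h2)))
      (Primrec.const 1) (Primrec.const 0)
  obtain ⟨c, hc⟩ := Nat.Partrec.Code.exists_code.1 (Partrec.nat_iff.1 hg.to_comp)
  refine ⟨fun i => Encodable.encode (c.curry i), ?_, fun i x y => ?_⟩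
  · exact (Primrec.encode.comp
      (Nat.Partrec.Code.primrec₂_curry.comp (Primrec.const c) Primrec.id)).to_comp
  · rw [phi, Denumerable.ofNat_encode, Nat.Partrec.Code.eval_curry, hc]
    change (K i x = K i y → _) ∧ (¬ K i x = K i y → _)
    constructor <;> intro h <;> simp [h]

-- Coding infinitude by pairs of classes

/-- A predicate whose complement is infinite, which is satisfied by `0`, and which is satisfied
infinitely often if and only if `P` is. -/
def Padded (P : ℕ → Prop) (m : ℕ) : Prop :=
  m = 0 ∨ m % 2 = 1 ∧ P (m / 2)

theorem infinite_padded_iff {P : ℕ → Prop} :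
    {m | Padded P m}.Infinite ↔ {k | P k}.Infinite := by
  constructor
  · intro h hfin
    refine h (((Set.finite_singleton 0).union (hfin.image fun k => 2 * k + 1)).subset ?_)
    rintro m (hm | ⟨hm, hP⟩)
    · exact Or.inl hm
    · exact Or.inr ⟨m / 2, hP, by change 2 * (m / 2) + 1 = m; omega⟩
  · intro h
    refine (h.image (f := fun k => 2 * k + 1) fun a _ b _ hab => by
      change 2 * a + 1 = 2 * b + 1 at hab; omega).mono ?_
    rintro _ ⟨k, hk, rfl⟩
    have h2 : (2 * k + 1) / 2 = k := by omega
    exact Or.inr ⟨by simp [Nat.add_mod], by rw [h2]; exact hk⟩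

theorem infinite_not_padded (P : ℕ → Prop) : {m | ¬ Padded P m}.Infinite := by
  refine Set.infinite_of_injective_forall_mem (f := fun k => 2 * k + 2)
    (fun a b hab => by change 2 * a + 2 = 2 * b + 2 at hab; omega) fun k => ?_
  rintro (h | ⟨h, -⟩) <;> omega

open Classical in
/-- The kernel of this function has the classes `{⟨a, m⟩ | Padded (P a) m}` and
`{⟨a, m⟩ | ¬ Padded (P a) m}` for all `a`. -/
noncomputable def twoClasses (P : ℕ → ℕ → Prop) (n : ℕ) : ℕ :=
  Nat.pair n.unpair.1 (if Padded (P n.unpair.1) n.unpair.2 then 0 else 1)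

theorem twoClasses_eq_iff {P : ℕ → ℕ → Prop} {n m : ℕ} :
    twoClasses P n = twoClasses P m ↔ n.unpair.1 = m.unpair.1 ∧
      (Padded (P n.unpair.1) n.unpair.2 ↔ Padded (P m.unpair.1) m.unpair.2) := by
  rw [twoClasses, twoClasses, Nat.pair_eq_pair]
  refine and_congr_right fun _ => ?_
  split_ifs with h1 h2 h2 <;> simp [h1, h2]

theorem primrecPred_padded {α : Type*} [Primcodable α] {P : α → ℕ → Prop} {m : α → ℕ}
    (hP : PrimrecPred fun p : α × ℕ => P p.1 p.2) (hm : Primrec m) :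
    PrimrecPred fun a => Padded (P a) (m a) := by
  refine PrimrecPred.or (Primrec.eq.comp hm (Primrec.const 0)) (PrimrecPred.and
    (Primrec.eq.comp (Primrec.nat_mod.comp hm (Primrec.const 2)) (Primrec.const 1)) ?_)
  exact hP.comp (Primrec.id.pair (Primrec.nat_div.comp hm (Primrec.const 2)))

open Classical in
theorem primrec₂_twoClasses {P : ℕ → ℕ → ℕ → Prop}
    (hP : PrimrecPred fun p : ℕ × ℕ × ℕ => P p.1 p.2.1 p.2.2) :
    Primrec₂ fun i => twoClasses (P i) := by
  have h2 : Primrec fun p : ℕ × ℕ => p.2.unpair := Primrec.unpair.comp Primrec.snd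
  refine Primrec₂.natPair.comp (Primrec.fst.comp h2)
    (Primrec.ite ?_ (Primrec.const 0) (Primrec.const 1))
  refine primrecPred_padded (P := fun p : ℕ × ℕ => P p.1 p.2.unpair.1) ?_ (Primrec.snd.comp h2)
  exact hP.comp ((Primrec.fst.comp Primrec.fst).pair
    ((Primrec.fst.comp (h2.comp Primrec.fst)).pair Primrec.snd))

theorem twoClasses_class_eq (P : ℕ → ℕ → Prop) (x : ℕ) :
    {z | Setoid.ker (twoClasses P) x z} = Nat.pair x.unpair.1 ''
      {m | Padded (P x.unpair.1) x.unpair.2 ↔ Padded (P x.unpair.1) m} := by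
  ext z
  change twoClasses P x = twoClasses P z ↔ _
  rw [twoClasses_eq_iff]
  constructor
  · rintro ⟨h1, h2⟩
    refine ⟨z.unpair.2, ?_, ?_⟩
    · rw [← h1] at h2; exact h2
    · rw [h1, Nat.pair_unpair]
  · rintro ⟨m, hm, rfl⟩
    simpa using hm

theorem encard_twoClasses_class (P : ℕ → ℕ → Prop) (x : ℕ) :
    {z | Setoid.ker (twoClasses P) x z}.encard =
      {m | Padded (P x.unpair.1) x.unpair.2 ↔ Padded (P x.unpair.1) m}.encard := by
  rw [twoClasses_class_eq]
  exact Function.Injective.encard_image (fun a b hab => (Nat.pair_eq_pair.1 hab).2) _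

/-- If `P a` holds infinitely often, then both classes which belong to `a` are infinite. -/
theorem encard_twoClasses_class_eq_top {P : ℕ → ℕ → Prop} {x : ℕ}
    (h : {k | P x.unpair.1 k}.Infinite) :
    {z | Setoid.ker (twoClasses P) x z}.encard = ⊤ := by
  rw [encard_twoClasses_class, Set.encard_eq_top_iff]
  by_cases hx : Padded (P x.unpair.1) x.unpair.2
  · simpa [hx] using infinite_padded_iff.2 h
  · simpa [hx] using infinite_not_padded (P x.unpair.1)

/-- If `P a` does not hold infinitely often, then one of the two classes which belong to `a`
is infinite and the other one is finite. -/
theorem not_encard_twoClasses_class_le {P : ℕ → ℕ → Prop} {a : ℕ}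
    (h : ¬ {k | P a k}.Infinite) :
    ¬ {z | Setoid.ker (twoClasses P) (Nat.pair a 2) z}.encard ≤
      {z | Setoid.ker (twoClasses P) (Nat.pair a 0) z}.encard := by
  rw [encard_twoClasses_class, encard_twoClasses_class]
  -- 0 always represents the padded class, and 2, being even and positive, its complement.
  have h0 : Padded (P a) 0 := Or.inl rfl
  have h2 : ¬ Padded (P a) 2 := by rintro (h | ⟨h, -⟩) <;> omega
  have h3 : {m | ¬ Padded (P a) m}.encard = ⊤ := (infinite_not_padded (P a)).encard_eq
  have h4 : {m | Padded (P a) m}.encard ≠ ⊤ := by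
    rwa [Ne, Set.encard_eq_top_iff, infinite_padded_iff]
  simpa [h0, h2, h3] using h4

theorem exists_reduction_UHQ {A : Set ℕ} (hA : IsPi 2 A) :
    ∃ f : ℕ → ℕ, Computable f ∧ (∀ i, f i ∈ EQ) ∧ ∀ i, i ∈ A ↔ f i ∈ UHQ := by
  obtain ⟨Q, hQ, hAQ⟩ := hA.exists_infinite_iff
  obtain ⟨f, hf, hfi⟩ := exists_computable_isIndexOf_ker (K := fun i => twoClasses fun _ => Q i)
    (primrec₂_twoClasses (P := fun i _ => Q i)
      (hQ.comp Primrec.fst (Primrec.snd.comp Primrec.snd)))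
  refine ⟨f, hf, fun i => ⟨_, hfi i⟩, fun i => ?_⟩
  rw [mem_UHQ_iff, hAQ]
  constructor
  · intro h
    refine ⟨_, hfi i, fun x y _ _ => ?_⟩
    rw [encard_twoClasses_class_eq_top (x := y) h]
    exact le_top
  · rintro ⟨s, hs, hE⟩
    rw [hs.unique (hfi i)] at hE
    by_contra h
    exact not_encard_twoClasses_class_le (P := fun _ => Q i) (a := 0) h
      (hE _ _ (by simp) (by simp))

/-- Taking all b ≤ a together makes the condition monotone in a, so a single witness leaves only
finitely many possibly finite classes, which constants can cover. -/
theorem exists_reduction_WUQ {A : Set ℕ} (hA : IsSigma 3 A) :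
    ∃ f : ℕ → ℕ, Computable f ∧ (∀ i, f i ∈ EQ) ∧ ∀ i, i ∈ A ↔ f i ∈ WUQ := by
  obtain ⟨B, hB, hAB⟩ := hA
  obtain ⟨Q, hQ, hBQ⟩ := hB.exists_infinite_iff
  let P : ℕ → ℕ → ℕ → Prop := fun i a k => ∃ b < a + 1, Q (Nat.pair i b) k
  have hP : PrimrecPred fun p : ℕ × ℕ × ℕ => P p.1 p.2.1 p.2.2 := by
    refine primrecPred_exists_lt (p := fun (p : ℕ × ℕ × ℕ) b => Q (Nat.pair p.1 b) p.2.2) ?_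
      (Primrec.succ.comp (Primrec.fst.comp Primrec.snd))
    exact hQ.comp (Primrec₂.natPair.comp (Primrec.fst.comp Primrec.fst) Primrec.snd)
      (Primrec.snd.comp (Primrec.snd.comp Primrec.fst))
  have hPinf : ∀ i a, {k | P i a k}.Infinite ↔ ∃ b < a + 1, Nat.pair i b ∈ B := by
    intro i a
    constructor
    · intro h
      by_contra! hn
      refine h (((Set.finite_Iio (a + 1)).biUnion (t := fun b => {k | Q (Nat.pair i b) k})
        fun b hb => by_contra fun hinf => hn b hb ((hBQ _).2 hinf)).subset ?_)
      rintro k ⟨b, hb, hk⟩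
      exact Set.mem_biUnion hb hk
    · rintro ⟨b, hb, hbB⟩
      exact ((hBQ _).1 hbB).mono fun k hk => ⟨b, hb, hk⟩
  obtain ⟨f, hf, hfi⟩ := exists_computable_isIndexOf_ker (primrec₂_twoClasses hP)
  refine ⟨f, hf, fun i => ⟨_, hfi i⟩, fun i => ?_⟩
  rw [mem_WUQ_iff, hAB]
  constructor
  · rintro ⟨b, hb⟩
    -- For a < b both representatives ⟨a, 0⟩ and ⟨a, 2⟩ lie below ⟨b, 3⟩, so the constants meet both
    -- classes of a.
    refine ⟨Nat.pair b 3, _, hfi i, fun x y hx hy => ?_⟩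
    have hby : b ≤ y.unpair.1 := by
      by_contra! hlt
      have hmem : ∀ m < 3, Nat.pair y.unpair.1 m < Nat.pair b 3 := fun m hm =>
        (Nat.pair_lt_pair_left _ hlt).trans (Nat.pair_lt_pair_right _ hm)
      have h0 : Padded (P i y.unpair.1) 0 := Or.inl rfl
      have h2 : ¬ Padded (P i y.unpair.1) 2 := by rintro (h | ⟨h, -⟩) <;> omega
      by_cases hp : Padded (P i y.unpair.1) y.unpair.2
      · refine hy _ (hmem 0 (by omega)) (twoClasses_eq_iff.2 ?_)
        simp [h0, hp]
      · refine hy _ (hmem 2 (by omega)) (twoClasses_eq_iff.2 ?_)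
        simp [h2, hp]
    rw [encard_twoClasses_class_eq_top (x := y) ((hPinf _ _).2 ⟨b, by omega, hb⟩)]
    exact le_top
  · rintro ⟨N, s, hs, hE⟩
    rw [hs.unique (hfi i)] at hE
    by_contra! h
    -- Every member of the two classes belonging to N is some ⟨N, m⟩ ≥ N, so neither class meets the
    -- constants below N.
    refine not_encard_twoClasses_class_le (P := P i) (a := N) ?_ (hE _ _ ?_ ?_)
    · rw [hPinf]
      rintro ⟨b, -, hb⟩
      exact h b hb
    all_goals
      intro a ha hax
      have h1 := (twoClasses_eq_iff.1 hax).1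
      rw [Nat.unpair_pair] at h1
      exact absurd (Nat.unpair_left_le a) (not_le.2 (h1 ▸ ha))

theorem IsCompleteRelativeTo.of_reduction {Γ : Set ℕ → Prop} {C B : Set ℕ} (hB : Γ B)
    (hBC : B ⊆ C) (h : ∀ A, Γ A → ∃ f : ℕ → ℕ, Computable f ∧ (∀ i, f i ∈ C) ∧
      ∀ i, i ∈ A ↔ f i ∈ B) : IsComplete Γ B ∧ IsCompleteRelativeTo Γ C B := by
  refine ⟨⟨hB, fun A hA => ?_⟩, ⟨B, hB, (Set.inter_eq_right.2 hBC).symm⟩, h⟩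
  obtain ⟨f, hf, -, hfA⟩ := h A hA
  exact ⟨f, hf, hfA⟩

end EqIndex

theorem mainTheorem6 :
    (EqIndex.IsComplete (EqIndex.IsPi 2) EqIndex.UHQ ∧
      EqIndex.IsCompleteRelativeTo (EqIndex.IsPi 2) EqIndex.EQ EqIndex.UHQ) ∧
    (EqIndex.IsComplete (EqIndex.IsSigma 3) EqIndex.WUQ ∧
      EqIndex.IsCompleteRelativeTo (EqIndex.IsSigma 3) EqIndex.EQ EqIndex.WUQ) :=
  ⟨EqIndex.IsCompleteRelativeTo.of_reduction EqIndex.isPi_two_UHQ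
      (fun _ ⟨s, hs, _⟩ => ⟨s, hs⟩) fun _ hA => EqIndex.exists_reduction_UHQ hA,
    EqIndex.IsCompleteRelativeTo.of_reduction EqIndex.isSigma_three_WUQ
      (fun _ ⟨s, hs, _⟩ => ⟨s, hs⟩) fun _ hA => EqIndex.exists_reduction_WUQ hA⟩
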